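/- Let $(X_i,Y_i)_{i\ge 1}$ be i.i.d. with $X_i\in\mathbb R^p$, $Y_i = X_i'\beta+\varepsilon_i$, $E|\varepsilon_i|<\infty$ and $E(\varepsilon_i\mid X_i)=0$. Let $\sigma^2:\mathbb R^p\to(0,\infty)$ be a measurable (possibly misspecified) model of the conditional variance. Suppose that all entries of the $2p\times p$ matrix $$G=\begin{pmatrix}E X_iX_i'\\ E\,\frac{1}{\sigma^2(X_i)}X_iX_i'\end{pmatrix}$$ are finite and that $G$ has full rank $p$. Suppose also that the covariance matrix of the joint OLS and WLS moment vector $(\varepsilon_iX_i',\ \varepsilon_iX_i'/\sigma^2(X_i))'$, $$\Omega=\begin{pmatrix}E\varepsilon_i^2X_iX_i' & E\frac{1}{\sigma^2(X_i)}\varepsilon_i^2X_iX_i'\\ E\frac{1}{\sigma^2(X_i)}\varepsilon_i^2X_iX_i' & E\frac{1}{\sigma^4(X_i)}\varepsilon_i^2X_iX_i'\end{pmatrix},$$ exists (finite entries) and is non-singular. Let $W=\Omega^{-1}$, with $p\times p$ blocks $W_{11},W_{12},W_{21},W_{22}$. For a sample of size $n$ let $X$ be the $p\times n$ matrix with columns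 $X_1,\dots,X_n$, let $Y=(Y_1,\dots,Y_n)'$, $D=\mathrm{diag}(1/\sigma^2(X_1),\dots,1/\sigma^2(X_n))$ and $\varepsilon(b)=Y-X'b$. A GALS estimator $\hat\beta^{GALS}$ is a minimizer over $b\in\mathbb R^p$ of the optimally weighted GMM criterion $$\frac1n\begin{pmatrix}X\varepsilon(b)\\ XD\varepsilon(b)\end{pmatrix}'W\begin{pmatrix}X\varepsilon(b)\\ XD\varepsilon(b)\end{pmatrix}.$$ Put $A_n=\frac1n\,(X'W_{11}X+X'W_{12}XD+DX'W_{21}X+DX'W_{22}XD)$. Then: 1. $A_n$ is symmetric and the GMM criterion equals $(Y-X'b)'A_n(Y-X'b)$. Whenever $XA_nX'$ is invertible, the minimizer is unique and equals the GLS estimator $(XA_nX')^{-1}(XA_nY)$. The probability that $XA_nX'$ is invertible tends to $1$. 2. $G'WG$ is positive definite and $\sqrt n(\hat\beta^{GALS}-\beta)\overset{d}{\to}N(0,(G'WG)^{-1})$. This holds for the closed form $(XA_nX')^{-1}(XA_nY)$ (set to $0$ when $XA_nX'$ is singular) and for every sequence of random vectors that minimize the criterion with probability tending to $1$. 3. $\hat\beta^{GALS}$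 is weakly more efficient than $\hat\beta^{OLS}=(XX')^{-1}XY$ and $\hat\beta^{WLS}=(XDX')^{-1}XDY$ (set to $0$ when the inverse does not exist). That is, $\sqrt n(\hat\beta^{OLS}-\beta)\overset{d}{\to}N(0,V_{OLS})$ and $\sqrt n(\hat\beta^{WLS}-\beta)\overset{d}{\to}N(0,V_{WLS})$, where $$V_{OLS}=(E X_iX_i')^{-1}\,E\varepsilon_i^2X_iX_i'\,(E X_iX_i')^{-1},$$ $$V_{WLS}=\Big(E\tfrac{1}{\sigma^2(X_i)}X_iX_i'\Big)^{-1}E\tfrac{1}{\sigma^4(X_i)}\varepsilon_i^2X_iX_i'\Big(E\tfrac{1}{\sigma^2(X_i)}X_iX_i'\Big)^{-1},$$ and both $V_{OLS}-(G'WG)^{-1}$ and $V_{WLS}-(G'WG)^{-1}$ are positive semidefinite. -/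

import Mathlib

open MeasureTheory ProbabilityTheory Filter Topology Matrix

noncomputable section

namespace GALS

/-! ### Sample quantities (fixed data) -/

section Sample

variable {p n : ℕ}

/-- Residuals `Y - X' b`; the regressor matrix `X` is `p × n`, one column per observation. -/
def resid (X : Matrix (Fin p) (Fin n) ℝ) (Y : Fin n → ℝ) (b : Fin p → ℝ) : Fin n → ℝ :=
  Y - Xᵀ *ᵥ b

/-- The stacked sample moments `(X ε(b), X D ε(b))`: OLS moments first, WLS moments second. -/
def stackedMoments (X : Matrix (Fin p) (Fin n) ℝ) (D : Matrix (Fin n) (Fin n) ℝ)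
    (Y : Fin n → ℝ) (b : Fin p → ℝ) : Fin p ⊕ Fin p → ℝ :=
  Sum.elim (X *ᵥ resid X Y b) (X *ᵥ (D *ᵥ resid X Y b))

/-- The joint GMM criterion with weight matrix `W`. -/
def gmmCriterion (W : Matrix (Fin p ⊕ Fin p) (Fin p ⊕ Fin p) ℝ)
    (X : Matrix (Fin p) (Fin n) ℝ) (D : Matrix (Fin n) (Fin n) ℝ)
    (Y : Fin n → ℝ) (b : Fin p → ℝ) : ℝ :=
  (1 / (n : ℝ)) * (stackedMoments X D Y b ⬝ᵥ W *ᵥ stackedMoments X D Y b)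

/-- `b` minimizes the joint GMM criterion over all of `ℝ^p`. -/
def IsGMMEstimator (W : Matrix (Fin p ⊕ Fin p) (Fin p ⊕ Fin p) ℝ)
    (X : Matrix (Fin p) (Fin n) ℝ) (D : Matrix (Fin n) (Fin n) ℝ)
    (Y : Fin n → ℝ) (b : Fin p → ℝ) : Prop :=
  ∀ b' : Fin p → ℝ, gmmCriterion W X D Y b ≤ gmmCriterion W X D Y b'

/-- The GLS criterion `(Y - X' b)' A (Y - X' b)`. -/
def glsCriterion (A : Matrix (Fin n) (Fin n) ℝ) (X : Matrix (Fin p) (Fin n) ℝ)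
    (Y : Fin n → ℝ) (b : Fin p → ℝ) : ℝ :=
  resid X Y b ⬝ᵥ A *ᵥ resid X Y b

/-- The closed form GLS estimator `(X A X')⁻¹ (X A Y)`. -/
def glsEstimator (A : Matrix (Fin n) (Fin n) ℝ) (X : Matrix (Fin p) (Fin n) ℝ)
    (Y : Fin n → ℝ) : Fin p → ℝ :=
  (X * A * Xᵀ)⁻¹ *ᵥ ((X * A) *ᵥ Y)

/-- `A_n = (1/n) (X' W₁₁ X + X' W₁₂ X D + D X' W₂₁ X + D X' W₂₂ X D)`. -/
def galsMatrix (W : Matrix (Fin p ⊕ Fin p) (Fin p ⊕ Fin p) ℝ)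
    (X : Matrix (Fin p) (Fin n) ℝ) (D : Matrix (Fin n) (Fin n) ℝ) :
    Matrix (Fin n) (Fin n) ℝ :=
  (1 / (n : ℝ)) • (Xᵀ * W.toBlocks₁₁ * X + Xᵀ * W.toBlocks₁₂ * X * D
    + D * Xᵀ * W.toBlocks₂₁ * X + D * Xᵀ * W.toBlocks₂₂ * X * D)

end Sample

/-! ### Data matrices built from the first `n` observations -/

section Data

variable {S : Type*} {p : ℕ}

/-- The `p × n` matrix whose columns are `X_0, …, X_{n-1}`. -/
def dataX (X : ℕ → S → Fin p → ℝ) (n : ℕ) (s : S) : Matrix (Fin p) (Fin n) ℝ :=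
  Matrix.of fun j i => X i s j

/-- The vector `(Y_0, …, Y_{n-1})`. -/
def dataY (Y : ℕ → S → ℝ) (n : ℕ) (s : S) : Fin n → ℝ :=
  fun i => Y i s

/-- `D = diag(1/σ²(X_0), …, 1/σ²(X_{n-1}))`. -/
def dataD (sigmaSq : (Fin p → ℝ) → ℝ) (X : ℕ → S → Fin p → ℝ) (n : ℕ) (s : S) :
    Matrix (Fin n) (Fin n) ℝ :=
  Matrix.diagonal fun i => 1 / sigmaSq (X i s)

end Data

/-! ### Population quantities -/

section Population

variable {S : Type*} [MeasurableSpace S] {p : ℕ}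

/-- All entries of the random matrix `w · x x'` have finite expectation. -/
def FiniteMoments (P : Measure S) (w : S → ℝ) (x : S → Fin p → ℝ) : Prop :=
  ∀ j k : Fin p, Integrable (fun s => w s * x s j * x s k) P

/-- The matrix `E[w · x x']`. -/
def momentMatrix (P : Measure S) (w : S → ℝ) (x : S → Fin p → ℝ) : Matrix (Fin p) (Fin p) ℝ :=
  Matrix.of fun j k => ∫ s, w s * x s j * x s k ∂P

/-- `E[x x']`. -/
def jacOLS (P : Measure S) (x : S → Fin p → ℝ) : Matrix (Fin p) (Fin p) ℝ :=
  momentMatrix P (fun _ => 1) x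

/-- `E[x x' / σ²(x)]`. -/
def jacWLS (P : Measure S) (sigmaSq : (Fin p → ℝ) → ℝ) (x : S → Fin p → ℝ) :
    Matrix (Fin p) (Fin p) ℝ :=
  momentMatrix P (fun s => 1 / sigmaSq (x s)) x

/-- The stacked `2p × p` matrix `G = (E x x', E x x'/σ²(x))'`. -/
def jac (P : Measure S) (sigmaSq : (Fin p → ℝ) → ℝ) (x : S → Fin p → ℝ) :
    Matrix (Fin p ⊕ Fin p) (Fin p) ℝ :=
  Matrix.fromRows (jacOLS P x) (jacWLS P sigmaSq x)

/-- `E[e² x x']`. -/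
def covOLS (P : Measure S) (x : S → Fin p → ℝ) (e : S → ℝ) : Matrix (Fin p) (Fin p) ℝ :=
  momentMatrix P (fun s => e s ^ 2) x

/-- `E[e² x x' / σ²(x)]`. -/
def covCross (P : Measure S) (sigmaSq : (Fin p → ℝ) → ℝ) (x : S → Fin p → ℝ) (e : S → ℝ) :
    Matrix (Fin p) (Fin p) ℝ :=
  momentMatrix P (fun s => e s ^ 2 / sigmaSq (x s)) x

/-- `E[e² x x' / σ⁴(x)]`. -/
def covWLS (P : Measure S) (sigmaSq : (Fin p → ℝ) → ℝ) (x : S → Fin p → ℝ) (e : S → ℝ) :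
    Matrix (Fin p) (Fin p) ℝ :=
  momentMatrix P (fun s => e s ^ 2 / sigmaSq (x s) ^ 2) x

/-- The covariance matrix of the joint moment vector `(e x, e x / σ²(x))` (which has mean zero). -/
def momentCov (P : Measure S) (sigmaSq : (Fin p → ℝ) → ℝ) (x : S → Fin p → ℝ) (e : S → ℝ) :
    Matrix (Fin p ⊕ Fin p) (Fin p ⊕ Fin p) ℝ :=
  Matrix.fromBlocks (covOLS P x e) (covCross P sigmaSq x e)
    (covCross P sigmaSq x e) (covWLS P sigmaSq x e)

/-- `√n (b_n - β)` converges in distribution to `N(0, V)`, where `V` is a genuine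
(positive semidefinite) covariance matrix. -/
def AsymptoticallyNormal (P : Measure S) [IsProbabilityMeasure P]
    (b : ℕ → S → Fin p → ℝ) (β : Fin p → ℝ) (V : Matrix (Fin p) (Fin p) ℝ) : Prop :=
  V.PosSemidef ∧
  TendstoInDistribution
    (fun (n : ℕ) (s : S) =>
      (WithLp.toLp 2 (Real.sqrt (n : ℝ) • (b n s - β)) : EuclideanSpace ℝ (Fin p)))
    atTop (id : EuclideanSpace ℝ (Fin p) → EuclideanSpace ℝ (Fin p))
    (fun _ => P) (multivariateGaussian 0 V)

end Population

end GALS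

end

/-!
The argument rests on one observation: OLS, WLS and GALS are all linear moment estimators for the
same instruments `z(x) = (x, x / σ²(x))`. Let `Z` be the matrix with columns `z(X_i)`, and let
`Ĝ = n⁻¹ Z X'`. Each estimator is the GLS estimator for some matrix `B` with `X B = K Z`, where
`K = (1 0)` for OLS, `K = (0 1)` for WLS and `K = Ĝ' W` for GALS, because
`A_n = n⁻¹ Z' W Z`. Substituting the model, whenever `K Ĝ` is invertible,
`√n (b̂ - β) = (K Ĝ)⁻¹ K · n^(-1/2) ∑ ε_i z(X_i)` (`glsEstimator_sub`).

The strong law gives `Ĝ → G` almost surely (`tendsto_sampleJac`), so `K Ĝ` converges to an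
invertible matrix and is itself invertible with probability tending to one. Exogeneity makes the
moments `ε_i z(X_i)` centered, and the multivariate central limit theorem (obtained from the
one-dimensional one through characteristic functions,
`tendstoInDistribution_multivariateGaussian`) gives the limit `N(0, Ω)` for their normalized sum.
Slutsky's theorem yields the limit `N(0, H Ω H')` with `H = (K G)⁻¹ K`
(`asymptoticallyNormal_glsEstimator`). The conventions for singular matrices do not matter, since
events of vanishing probability do not affect a limit in distribution
(`tendstoInDistribution_of_tendsto_measure_ne`).

Every such `H` satisfies `H G = 1`, and for `H₀ = (G' W G)⁻¹ G' W` the Gauss–Markov identity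
`H Ω H' - (G' W G)⁻¹ = (H - H₀) Ω (H - H₀)'` gives the efficiency comparison
(`posSemidef_sandwich_sub`). That `E X X'` and `E X X' / σ²` are separately invertible follows from
the full rank of the stacked `G`: the kernel of either one consists of the `v` with `v' X = 0`
almost surely, which lies in the kernel of both blocks.
-/

namespace GALS

/-! ### Generalized least squares algebra -/

section LinearAlgebra

variable {p n : ℕ} {ι : Type*} [Fintype ι]

/-- The stacked matrix with row blocks `X` and `X D`: the columns are the joint OLS and WLS
instruments of the observations. -/
noncomputable def stack (X : Matrix (Fin p) (Fin n) ℝ) (D : Matrix (Fin n) (Fin n) ℝ) :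
    Matrix (Fin p ⊕ Fin p) (Fin n) ℝ :=
  Matrix.fromRows X (X * D)

theorem stackedMoments_eq (X : Matrix (Fin p) (Fin n) ℝ) (D : Matrix (Fin n) (Fin n) ℝ)
    (Y : Fin n → ℝ) (b : Fin p → ℝ) :
    stackedMoments X D Y b = stack X D *ᵥ resid X Y b := by
  rw [stack, Matrix.fromRows_mulVec, stackedMoments, Matrix.mulVec_mulVec]

/-- `A_n = n⁻¹ Z' W Z` for the stacked instruments `Z`. -/
theorem galsMatrix_eq (W : Matrix (Fin p ⊕ Fin p) (Fin p ⊕ Fin p) ℝ)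
    (X : Matrix (Fin p) (Fin n) ℝ) {D : Matrix (Fin n) (Fin n) ℝ} (hD : D.IsSymm) :
    galsMatrix W X D = (1 / (n : ℝ)) • ((stack X D)ᵀ * W * stack X D) := by
  unfold galsMatrix stack
  conv_rhs => rw [← Matrix.fromBlocks_toBlocks W]
  rw [Matrix.transpose_fromRows, Matrix.transpose_mul, hD.eq, Matrix.fromCols_mul_fromBlocks,
    Matrix.fromCols_mul_fromRows]
  congr 1
  simp only [Matrix.add_mul, Matrix.mul_assoc]
  abel

theorem galsMatrix_posSemidef {W : Matrix (Fin p ⊕ Fin p) (Fin p ⊕ Fin p) ℝ}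
    (hW : W.PosSemidef) (X : Matrix (Fin p) (Fin n) ℝ) {D : Matrix (Fin n) (Fin n) ℝ}
    (hD : D.IsSymm) : (galsMatrix W X D).PosSemidef := by
  rw [galsMatrix_eq W X hD, ← conjTranspose_eq_transpose_of_trivial]
  exact (hW.conjTranspose_mul_mul_same _).smul (by positivity)

theorem gmmCriterion_eq_glsCriterion (W : Matrix (Fin p ⊕ Fin p) (Fin p ⊕ Fin p) ℝ)
    (X : Matrix (Fin p) (Fin n) ℝ) {D : Matrix (Fin n) (Fin n) ℝ} (hD : D.IsSymm)
    (Y : Fin n → ℝ) (b : Fin p → ℝ) :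
    gmmCriterion W X D Y b = glsCriterion (galsMatrix W X D) X Y b := by
  rw [gmmCriterion, glsCriterion, galsMatrix_eq W X hD, stackedMoments_eq, Matrix.smul_mulVec,
    dotProduct_smul, smul_eq_mul, ← Matrix.mulVec_mulVec, ← Matrix.mulVec_mulVec,
    Matrix.dotProduct_mulVec _ (stack X D)ᵀ, Matrix.vecMul_transpose]

theorem dotProduct_mulVec_comm_of_isSymm {A : Matrix ι ι ℝ} (hA : A.IsSymm) (u v : ι → ℝ) :
    u ⬝ᵥ A *ᵥ v = v ⬝ᵥ A *ᵥ u := by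
  rw [Matrix.dotProduct_mulVec, ← Matrix.mulVec_transpose, hA.eq, dotProduct_comm]

/-- Completing the square: the closed form solves the first-order condition, so the criterion
exceeds its value there by a quadratic form in the deviation. -/
theorem glsCriterion_eq_add {A : Matrix (Fin n) (Fin n) ℝ} (hA : A.IsSymm)
    (X : Matrix (Fin p) (Fin n) ℝ) (Y : Fin n → ℝ) (hdet : IsUnit (X * A * Xᵀ).det)
    (b : Fin p → ℝ) :
    glsCriterion A X Y b = glsCriterion A X Y (glsEstimator A X Y)
      + (b - glsEstimator A X Y) ⬝ᵥ (X * A * Xᵀ) *ᵥ (b - glsEstimator A X Y) := by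
  set c := glsEstimator A X Y with hc
  set d := b - c with hd
  have hb : resid X Y b = resid X Y c - Xᵀ *ᵥ d := by
    simp [resid, hd, Matrix.mulVec_sub]
  have h0 : (X * A) *ᵥ resid X Y c = 0 := by
    rw [resid, Matrix.mulVec_sub, Matrix.mulVec_mulVec, hc, glsEstimator, Matrix.mulVec_mulVec,
      Matrix.mul_nonsing_inv _ hdet, Matrix.one_mulVec, sub_self]
  have h1 : (Xᵀ *ᵥ d) ⬝ᵥ A *ᵥ resid X Y c = 0 := by
    rw [Matrix.mulVec_transpose, ← Matrix.dotProduct_mulVec, Matrix.mulVec_mulVec, h0,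
      dotProduct_zero]
  have h2 : (Xᵀ *ᵥ d) ⬝ᵥ A *ᵥ (Xᵀ *ᵥ d) = d ⬝ᵥ (X * A * Xᵀ) *ᵥ d := by
    rw [Matrix.mulVec_transpose, ← Matrix.dotProduct_mulVec, ← Matrix.mulVec_transpose,
      Matrix.mulVec_mulVec, Matrix.mulVec_mulVec, Matrix.mul_assoc]
  have h3 := dotProduct_mulVec_comm_of_isSymm hA (resid X Y c) (Xᵀ *ᵥ d)
  unfold glsCriterion
  rw [hb, Matrix.mulVec_sub A, sub_dotProduct, dotProduct_sub, dotProduct_sub, h3, h1, h2]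
  ring

theorem isGMMEstimator_iff {W : Matrix (Fin p ⊕ Fin p) (Fin p ⊕ Fin p) ℝ}
    (hW : W.PosSemidef) (X : Matrix (Fin p) (Fin n) ℝ) {D : Matrix (Fin n) (Fin n) ℝ}
    (hD : D.IsSymm) (Y : Fin n → ℝ) (hdet : IsUnit (X * galsMatrix W X D * Xᵀ).det)
    (b : Fin p → ℝ) :
    IsGMMEstimator W X D Y b ↔ b = glsEstimator (galsMatrix W X D) X Y := by
  have hA := galsMatrix_posSemidef hW X hD
  have hAs : (galsMatrix W X D).IsSymm := by
    rw [Matrix.IsSymm, ← conjTranspose_eq_transpose_of_trivial]; exact hA.isHermitian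
  have hpd : (X * galsMatrix W X D * Xᵀ).PosDef := by
    have h := hA.mul_mul_conjTranspose_same X
    rw [conjTranspose_eq_transpose_of_trivial] at h
    exact h.posDef_iff_isUnit.2 ((Matrix.isUnit_iff_isUnit_det _).2 hdet)
  simp only [IsGMMEstimator, gmmCriterion_eq_glsCriterion W X hD]
  constructor
  · intro h
    by_contra hne
    have h1 := h (glsEstimator (galsMatrix W X D) X Y)
    rw [glsCriterion_eq_add hAs X Y hdet b] at h1
    have h2 := hpd.dotProduct_mulVec_pos (sub_ne_zero.2 hne)
    simp only [star_trivial] at h2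
    linarith
  · rintro rfl b'
    rw [glsCriterion_eq_add hAs X Y hdet b']
    have h2 := hpd.posSemidef.dotProduct_mulVec_nonneg
      (b' - glsEstimator (galsMatrix W X D) X Y)
    simp only [star_trivial] at h2
    linarith

/-- Gauss–Markov bound: among the left inverses `H` of `G`, the covariance `H Ω H'` is bounded
below by `(G' Ω⁻¹ G)⁻¹`, since the difference is `(H - H₀) Ω (H - H₀)'` for
`H₀ = (G' Ω⁻¹ G)⁻¹ G' Ω⁻¹`. -/
theorem posSemidef_sandwich_sub [DecidableEq ι] {Ω : Matrix ι ι ℝ} (hΩ : Ω.PosDef) {G : Matrix ι (Fin p) ℝ}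
    (hG : IsUnit (Gᵀ * Ω⁻¹ * G).det) {H : Matrix (Fin p) ι ℝ} (hH : H * G = 1) :
    (H * Ω * Hᵀ - (Gᵀ * Ω⁻¹ * G)⁻¹).PosSemidef := by
  have hu : IsUnit Ω.det := hΩ.det_pos.ne'.isUnit
  have hs : Ωᵀ = Ω := by rw [← conjTranspose_eq_transpose_of_trivial]; exact hΩ.isHermitian
  set Q := (Gᵀ * Ω⁻¹ * G)⁻¹ with hQ
  have hQs : Qᵀ = Q := by
    rw [hQ, Matrix.transpose_nonsing_inv]
    simp only [Matrix.transpose_mul, Matrix.transpose_transpose, Matrix.transpose_nonsing_inv, hs,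
      Matrix.mul_assoc]
  have hGH : Gᵀ * Hᵀ = 1 := by rw [← Matrix.transpose_mul, hH, Matrix.transpose_one]
  have key : H * Ω * Hᵀ - Q
      = (H - Q * (Gᵀ * Ω⁻¹)) * Ω * (H - Q * (Gᵀ * Ω⁻¹))ᵀ := by
    have e1 : (H - Q * (Gᵀ * Ω⁻¹))ᵀ = Hᵀ - Ω⁻¹ * G * Q := by
      simp only [Matrix.transpose_sub, Matrix.transpose_mul, Matrix.transpose_transpose,
        Matrix.transpose_nonsing_inv, hs, hQs]
    have e2 : H * Ω * (Ω⁻¹ * G * Q) = Q := by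
      rw [show H * Ω * (Ω⁻¹ * G * Q) = H * (Ω * Ω⁻¹) * G * Q by simp only [Matrix.mul_assoc],
        Matrix.mul_nonsing_inv _ hu, Matrix.mul_one, hH, Matrix.one_mul]
    have e3 : Q * (Gᵀ * Ω⁻¹) * Ω * Hᵀ = Q := by
      rw [show Q * (Gᵀ * Ω⁻¹) * Ω * Hᵀ = Q * Gᵀ * (Ω⁻¹ * Ω) * Hᵀ by simp only [Matrix.mul_assoc],
        Matrix.nonsing_inv_mul _ hu, Matrix.mul_one, Matrix.mul_assoc, hGH, Matrix.mul_one]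
    have e4 : Q * (Gᵀ * Ω⁻¹) * Ω * (Ω⁻¹ * G * Q) = Q := by
      rw [show Q * (Gᵀ * Ω⁻¹) * Ω * (Ω⁻¹ * G * Q) = Q * Gᵀ * Ω⁻¹ * (Ω * Ω⁻¹) * G * Q by
          simp only [Matrix.mul_assoc],
        Matrix.mul_nonsing_inv _ hu, Matrix.mul_one,
        show Q * Gᵀ * Ω⁻¹ * G * Q = Q * (Gᵀ * Ω⁻¹ * G) * Q by simp only [Matrix.mul_assoc],
        hQ, Matrix.nonsing_inv_mul _ hG, Matrix.one_mul]
    rw [e1, Matrix.sub_mul, Matrix.sub_mul, Matrix.mul_sub, Matrix.mul_sub, e2, e3, e4]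
    abel
  rw [key, ← conjTranspose_eq_transpose_of_trivial]
  exact hΩ.posSemidef.mul_mul_conjTranspose_same _

/-- The optimal weight `W = Ω⁻¹` attains the Gauss–Markov bound: the sandwich covariance
collapses. -/
theorem sandwich_optimal [DecidableEq ι] {Ω : Matrix ι ι ℝ} (hΩ : Ω.PosDef) {G : Matrix ι (Fin p) ℝ}
    (hG : IsUnit (Gᵀ * Ω⁻¹ * G).det) :
    ((Gᵀ * Ω⁻¹ * G)⁻¹ * (Gᵀ * Ω⁻¹)) * Ω * ((Gᵀ * Ω⁻¹ * G)⁻¹ * (Gᵀ * Ω⁻¹))ᵀ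
      = (Gᵀ * Ω⁻¹ * G)⁻¹ := by
  have hu : IsUnit Ω.det := hΩ.det_pos.ne'.isUnit
  have hs : Ωᵀ = Ω := by rw [← conjTranspose_eq_transpose_of_trivial]; exact hΩ.isHermitian
  have hQs : ((Gᵀ * Ω⁻¹ * G)⁻¹)ᵀ = (Gᵀ * Ω⁻¹ * G)⁻¹ := by
    rw [Matrix.transpose_nonsing_inv]
    simp only [Matrix.transpose_mul, Matrix.transpose_transpose, Matrix.transpose_nonsing_inv, hs,
      Matrix.mul_assoc]
  set Q := (Gᵀ * Ω⁻¹ * G)⁻¹ with hQ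
  rw [Matrix.transpose_mul, Matrix.transpose_mul, Matrix.transpose_transpose,
    Matrix.transpose_nonsing_inv, hs, hQs,
    show Q * (Gᵀ * Ω⁻¹) * Ω * (Ω⁻¹ * G * Q) = Q * Gᵀ * Ω⁻¹ * (Ω * Ω⁻¹) * G * Q by
      simp only [Matrix.mul_assoc],
    Matrix.mul_nonsing_inv _ hu, Matrix.mul_one,
    show Q * Gᵀ * Ω⁻¹ * G * Q = Q * (Gᵀ * Ω⁻¹ * G) * Q by simp only [Matrix.mul_assoc],
    hQ, Matrix.nonsing_inv_mul _ hG, Matrix.one_mul]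

/-- Estimation error of a GLS estimator whose normal equations are `K Z (Y - X' b) = 0`. The
nonzero scalar `c` cancels; it is kept so that sums can be read as sample averages. -/
theorem glsEstimator_sub {B : Matrix (Fin n) (Fin n) ℝ} {X : Matrix (Fin p) (Fin n) ℝ}
    {Z : Matrix ι (Fin n) ℝ} {K : Matrix (Fin p) ι ℝ} (hB : X * B = K * Z)
    (β : Fin p → ℝ) (e : Fin n → ℝ) {c : ℝ} (hc : c ≠ 0)
    (hdet : IsUnit (K * (c • (Z * Xᵀ))).det) :
    glsEstimator B X (Xᵀ *ᵥ β + e) - β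
      = ((K * (c • (Z * Xᵀ)))⁻¹ * K) *ᵥ (c • (Z *ᵥ e)) := by
  have h1 : X * B * Xᵀ = c⁻¹ • (K * (c • (Z * Xᵀ))) := by
    rw [hB, Matrix.mul_smul, smul_smul, inv_mul_cancel₀ hc, one_smul, Matrix.mul_assoc]
  set M := K * (c • (Z * Xᵀ)) with hM
  have h2 : (X * B * Xᵀ)⁻¹ = c • M⁻¹ := by
    rw [h1]
    apply Matrix.inv_eq_left_inv
    rw [Matrix.smul_mul, Matrix.mul_smul, smul_smul, mul_inv_cancel₀ hc, one_smul,
      Matrix.nonsing_inv_mul _ hdet]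
  have h3 : (X * B * Xᵀ)⁻¹ * (X * B) * Xᵀ = 1 := by
    rw [Matrix.mul_assoc, h2, h1, Matrix.smul_mul, Matrix.mul_smul, smul_smul, mul_inv_cancel₀ hc, one_smul,
      Matrix.nonsing_inv_mul _ hdet]
  rw [glsEstimator, Matrix.mulVec_add, Matrix.mulVec_add, Matrix.mulVec_mulVec,
    Matrix.mulVec_mulVec, h3, Matrix.one_mulVec, add_sub_cancel_left, h2, hB,
    Matrix.smul_mulVec, Matrix.mulVec_smul]
  simp only [Matrix.mulVec_mulVec, Matrix.mul_assoc]

end LinearAlgebra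

/-! ### Limit theorems for random vectors and random matrices -/

section Probability

variable {S : Type*} [MeasurableSpace S] {P : Measure S} {ι κ : Type*} [Fintype ι]
  [Fintype κ]

theorem integral_dotProduct_sq {ξ : S → ι → ℝ} (hξ : ∀ j, MemLp (fun s => ξ s j) 2 P)
    {Ω : Matrix ι ι ℝ} (hΩ : ∀ j k, ∫ s, ξ s j * ξ s k ∂P = Ω j k) (t : ι → ℝ) :
    ∫ s, (t ⬝ᵥ ξ s) ^ 2 ∂P = t ⬝ᵥ Ω *ᵥ t := by
  have hint : ∀ j k, Integrable (fun s => ξ s j * ξ s k) P :=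
    fun j k => (hξ j).integrable_mul (hξ k)
  have h1 : ∀ s, (t ⬝ᵥ ξ s) ^ 2 = ∑ j, ∑ k, t j * t k * (ξ s j * ξ s k) := by
    intro s
    rw [sq, dotProduct, Finset.sum_mul_sum]
    exact Finset.sum_congr rfl fun j _ => Finset.sum_congr rfl fun k _ => by ring
  simp_rw [h1]
  rw [integral_finsetSum _ fun j _ => integrable_finsetSum _ fun k _ => (hint j k).const_mul _]
  rw [dotProduct]
  refine Finset.sum_congr rfl fun j _ => ?_
  rw [integral_finsetSum _ fun k _ => (hint j k).const_mul _, Matrix.mulVec, dotProduct,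
    Finset.mul_sum]
  refine Finset.sum_congr rfl fun k _ => ?_
  rw [integral_const_mul, hΩ]
  ring

theorem posSemidef_of_secondMoment {ξ : S → ι → ℝ} (hξ : ∀ j, MemLp (fun s => ξ s j) 2 P)
    {Ω : Matrix ι ι ℝ} (hΩ : ∀ j k, ∫ s, ξ s j * ξ s k ∂P = Ω j k) : Ω.PosSemidef := by
  refine Matrix.PosSemidef.of_dotProduct_mulVec_nonneg ?_ fun t => ?_
  · ext j k
    simp only [conjTranspose_apply, star_trivial, ← hΩ, mul_comm]
  · rw [star_trivial, ← integral_dotProduct_sq hξ hΩ t]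
    exact integral_nonneg fun s => sq_nonneg _

theorem tendsto_average_ae {f : ℕ → S → ℝ} (hint : Integrable (f 0) P) (hindep : iIndepFun f P)
    (hident : ∀ i, IdentDistrib (f i) (f 0) P P) :
    ∀ᵐ s ∂P, Tendsto (fun n : ℕ => (n : ℝ)⁻¹ * ∑ i ∈ Finset.range n, f i s) atTop
      (𝓝 (∫ s, f 0 s ∂P)) := by
  have := strong_law_ae f hint (fun i j hij => hindep.indepFun hij) hident
  simpa only [smul_eq_mul] using this

variable [DecidableEq ι] [DecidableEq κ]
variable [IsProbabilityMeasure P]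

/-- **Multivariate central limit theorem** for centered i.i.d. vectors with second moment matrix
`Ω` (possibly singular). By Lévy's theorem it is enough to look at characteristic functions, and at
`t` these are characteristic functions at `1` of the real variables `⟨t, ξ_i⟩`, to which the
one-dimensional theorem applies. -/
theorem tendstoInDistribution_multivariateGaussian {ξ : ℕ → S → ι → ℝ}
    (hξ : ∀ j, MemLp (fun s => ξ 0 s j) 2 P) (hmean : ∀ j, ∫ s, ξ 0 s j ∂P = 0)
    (hindep : iIndepFun ξ P) (hident : ∀ i, IdentDistrib (ξ i) (ξ 0) P P)
    {Ω : Matrix ι ι ℝ} (hΩ : ∀ j k, ∫ s, ξ 0 s j * ξ 0 s k ∂P = Ω j k) :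
    TendstoInDistribution
      (fun (n : ℕ) (s : S) =>
        (WithLp.toLp 2 ((√(n : ℝ))⁻¹ • ∑ i ∈ Finset.range n, ξ i s) : EuclideanSpace ℝ ι))
      atTop (id : EuclideanSpace ℝ ι → EuclideanSpace ℝ ι) (fun _ => P)
      (multivariateGaussian 0 Ω) := by
  have hpsd := posSemidef_of_secondMoment hξ hΩ
  have hmeas : ∀ i, AEMeasurable (ξ i) P := fun i => (hident i).aemeasurable_fst
  have hsum : ∀ n : ℕ, AEMeasurable (fun s => (√(n : ℝ))⁻¹ • ∑ i ∈ Finset.range n, ξ i s) P :=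
    fun n => (Finset.aemeasurable_fun_sum (Finset.range n) fun i _ => hmeas i).const_smul
      (√(n : ℝ))⁻¹
  have hsum' : ∀ n : ℕ, AEMeasurable (fun s =>
      (WithLp.toLp 2 ((√(n : ℝ))⁻¹ • ∑ i ∈ Finset.range n, ξ i s) : EuclideanSpace ℝ ι)) P :=
    fun n => (WithLp.measurable_toLp 2 _).comp_aemeasurable (hsum n)
  refine ⟨hsum', aemeasurable_id, ?_⟩
  refine ProbabilityMeasure.tendsto_iff_tendsto_charFun.2 fun t => ?_
  have hdot : Measurable fun x : ι → ℝ => WithLp.ofLp t ⬝ᵥ x := by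
    unfold dotProduct; fun_prop
  set η : ℕ → S → ℝ := fun i s => WithLp.ofLp t ⬝ᵥ ξ i s with hη
  have hηmem : MemLp (η 0) 2 P := by
    simp only [hη, dotProduct]
    exact memLp_finsetSum _ fun j _ => (hξ j).const_mul _
  have hηmean : P[η 0] = 0 := by
    simp only [hη, dotProduct]
    rw [integral_finsetSum _ fun j _ => ((hξ j).integrable (by norm_num)).const_mul _]
    simp [integral_const_mul, hmean]
  have hvar : Var[η 0; P] = WithLp.ofLp t ⬝ᵥ Ω *ᵥ WithLp.ofLp t := by
    rw [variance_of_integral_eq_zero hηmem.aemeasurable hηmean]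
    exact integral_dotProduct_sq hξ hΩ _
  have hclt := tendstoInDistribution_inv_sqrt_mul_sum_sub (P := P) (X := η)
    (P' := gaussianReal 0 Var[η 0; P].toNNReal) (Y := id) HasLaw.id hηmem
    (hindep.comp (fun _ x => WithLp.ofLp t ⬝ᵥ x) fun _ => hdot)
    (fun i => (hident i).comp hdot)
  have hcf := ProbabilityMeasure.tendsto_iff_tendsto_charFun.1 hclt.tendsto 1
  have hlim : charFun ((gaussianReal 0 Var[η 0; P].toNNReal).map id) 1
      = charFun ((multivariateGaussian 0 Ω).map id) t := by
    rw [Measure.map_id, Measure.map_id, charFun_gaussianReal, charFun_multivariateGaussian hpsd,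
      Real.coe_toNNReal _ (variance_nonneg _ _), hvar]
    simp
  have hseq : ∀ n : ℕ, charFun (P.map fun s =>
        (√(n : ℝ))⁻¹ * (∑ i ∈ Finset.range n, η i s - n * P[η 0])) 1
      = charFun (P.map fun s =>
      (WithLp.toLp 2 ((√(n : ℝ))⁻¹ • ∑ i ∈ Finset.range n, ξ i s) : EuclideanSpace ℝ ι)) t := by
    intro n
    have hm : AEMeasurable
        (fun s => (√(n : ℝ))⁻¹ * (∑ i ∈ Finset.range n, η i s - n * P[η 0])) P :=
      hclt.forall_aemeasurable n
    rw [charFun_apply, charFun_apply, integral_map hm (by fun_prop),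
      integral_map (hsum' n) (by fun_prop)]
    refine integral_congr_ae (ae_of_all _ fun s => ?_)
    simp only [hηmean, mul_zero, sub_zero]
    rw [EuclideanSpace.inner_eq_star_dotProduct]
    simp only [star_trivial, dotProduct_smul, hη, dotProduct_sum, smul_eq_mul]
    simp
  simp only [ProbabilityMeasure.coe_mk] at hcf ⊢
  rw [hlim] at hcf
  exact hcf.congr hseq

/-- A limit in distribution is unaffected by changes on events of vanishing probability. The
exceptional sets need not be measurable. -/
theorem tendstoInDistribution_of_tendsto_measure_ne {E : Type*} [NormedAddCommGroup E]
    [SecondCountableTopology E] [MeasurableSpace E] [BorelSpace E] {S' : Type*}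
    [MeasurableSpace S'] {Q : Measure S'} [IsProbabilityMeasure Q] {T U : ℕ → S → E} {Z : S' → E}
    (hT : TendstoInDistribution T atTop Z (fun _ => P) Q) (hU : ∀ n, AEMeasurable (U n) P)
    (hne : Tendsto (fun n => P {s | U n s ≠ T n s}) atTop (𝓝 0)) :
    TendstoInDistribution U atTop Z (fun _ => P) Q := by
  refine tendstoInDistribution_of_tendstoInMeasure_sub U Z hT ?_ hU
  rw [tendstoInMeasure_iff_norm]
  intro r hr
  refine tendsto_of_tendsto_of_tendsto_of_le_of_le tendsto_const_nhds hne
    (fun _ => bot_le) fun n => measure_mono fun s hs => ?_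
  simp only [Set.mem_ofPred_eq, Pi.sub_apply, Pi.zero_apply, sub_zero] at hs ⊢
  intro h
  rw [h, sub_self, norm_zero] at hs
  exact hs.not_gt hr

theorem map_mulVec_multivariateGaussian {Ω : Matrix ι ι ℝ} (hΩ : Ω.PosSemidef)
    (H : Matrix κ ι ℝ) :
    (multivariateGaussian 0 Ω).map
        (fun x => (WithLp.toLp 2 (H *ᵥ WithLp.ofLp x) : EuclideanSpace ℝ κ))
      = multivariateGaussian 0 (H * Ω * Hᵀ) := by
  have hH : (H * Ω * Hᵀ).PosSemidef := by
    rw [← conjTranspose_eq_transpose_of_trivial]; exact hΩ.mul_mul_conjTranspose_same H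
  have hcont : Continuous
      (fun x : EuclideanSpace ℝ ι => (WithLp.toLp 2 (H *ᵥ WithLp.ofLp x) : EuclideanSpace ℝ κ)) := by
    fun_prop
  have : IsProbabilityMeasure ((multivariateGaussian 0 Ω).map
        (fun x => (WithLp.toLp 2 (H *ᵥ WithLp.ofLp x) : EuclideanSpace ℝ κ))) :=
    Measure.isProbabilityMeasure_map hcont.aemeasurable
  refine Measure.ext_of_charFun (funext fun t => ?_)
  have h1 : charFun ((multivariateGaussian 0 Ω).map
        (fun x => (WithLp.toLp 2 (H *ᵥ WithLp.ofLp x) : EuclideanSpace ℝ κ))) t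
      = charFun (multivariateGaussian 0 Ω) (WithLp.toLp 2 (Hᵀ *ᵥ WithLp.ofLp t)) := by
    rw [charFun_apply, charFun_apply, integral_map hcont.aemeasurable (by fun_prop)]
    refine integral_congr_ae (ae_of_all _ fun x => ?_)
    simp only [EuclideanSpace.inner_eq_star_dotProduct, star_trivial]
    rw [Matrix.mulVec_transpose, ← Matrix.dotProduct_mulVec]
  rw [h1, charFun_multivariateGaussian hΩ, charFun_multivariateGaussian hH]
  simp only [inner_zero_right]
  rw [Matrix.mulVec_transpose, ← Matrix.dotProduct_mulVec, ← Matrix.mulVec_transpose,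
    Matrix.mulVec_mulVec, Matrix.mulVec_mulVec, Matrix.mul_assoc]

/-- Slutsky's theorem for a random matrix with a constant limit acting on an asymptotically
Gaussian vector. -/
theorem tendstoInDistribution_mulVec {T : ℕ → S → EuclideanSpace ℝ ι} {Ω : Matrix ι ι ℝ}
    (hΩ : Ω.PosSemidef)
    (hT : TendstoInDistribution T atTop id (fun _ => P) (multivariateGaussian 0 Ω))
    {H : ℕ → S → Matrix κ ι ℝ} {H₀ : Matrix κ ι ℝ}
    (hHm : ∀ n i j, Measurable fun s => H n s i j)
    (hH : ∀ᵐ s ∂P, Tendsto (fun n => H n s) atTop (𝓝 H₀)) :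
    TendstoInDistribution
      (fun n s => (WithLp.toLp 2 (H n s *ᵥ WithLp.ofLp (T n s)) : EuclideanSpace ℝ κ))
      atTop (id : EuclideanSpace ℝ κ → EuclideanSpace ℝ κ) (fun _ => P)
      (multivariateGaussian 0 (H₀ * Ω * H₀ᵀ)) := by
  let H' : ℕ → S → κ → ι → ℝ := H
  have hH'm : ∀ n, Measurable (H' n) :=
    fun n => measurable_pi_iff.2 fun i => measurable_pi_iff.2 fun j => hHm n i j
  have hlim : TendstoInMeasure P H' atTop fun _ => (H₀ : κ → ι → ℝ) :=
    tendstoInMeasure_of_tendsto_ae (fun n => (hH'm n).aestronglyMeasurable) hH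
  have hg : Continuous fun x : EuclideanSpace ℝ ι × (κ → ι → ℝ) =>
      (WithLp.toLp 2 ((Matrix.of x.2) *ᵥ WithLp.ofLp x.1) : EuclideanSpace ℝ κ) := by
    refine (PiLp.continuous_toLp 2 _).comp (continuous_pi fun i => ?_)
    simp only [Matrix.mulVec, dotProduct, Matrix.of_apply]
    fun_prop
  have h := hT.continuous_comp_prodMk_of_tendstoInMeasure_const hg hlim
    fun n => (hH'm n).aemeasurable
  refine ⟨h.forall_aemeasurable, aemeasurable_id, ?_⟩
  have hlimit : (⟨(multivariateGaussian 0 (H₀ * Ω * H₀ᵀ)).map id,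
        Measure.isProbabilityMeasure_map aemeasurable_id⟩ :
        ProbabilityMeasure (EuclideanSpace ℝ κ))
      = ⟨(multivariateGaussian 0 Ω).map _,
        Measure.isProbabilityMeasure_map h.aemeasurable_limit⟩ :=
    Subtype.ext (Measure.map_id.trans (map_mulVec_multivariateGaussian hΩ H₀).symm)
  rw [hlimit]
  exact h.tendsto

theorem tendsto_measure_one_of_ae_eventually {A : ℕ → Set S} (hA : ∀ n, MeasurableSet (A n))
    (h : ∀ᵐ s ∂P, ∀ᶠ n in atTop, s ∈ A n) : Tendsto (fun n => P (A n)) atTop (𝓝 1) := by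
  have := tendsto_measure_of_ae_tendsto_indicator_of_isFiniteMeasure (μ := P) atTop
    MeasurableSet.univ hA (by filter_upwards [h] with s hs; simpa using hs)
  simpa using this

theorem measurable_inv_apply {M : S → Matrix κ κ ℝ} (hM : ∀ i j, Measurable fun s => M s i j)
    (i j : κ) : Measurable fun s => (M s)⁻¹ i j := by
  let M' : S → κ → κ → ℝ := M
  have hM' : Measurable M' :=
    measurable_pi_iff.2 fun i => measurable_pi_iff.2 fun j => hM i j
  have hdet : Continuous fun N : κ → κ → ℝ => (Matrix.of N).det :=
    Continuous.matrix_det (continuous_id (X := Matrix κ κ ℝ))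
  have hadj : Continuous fun N : κ → κ → ℝ => (Matrix.of N).adjugate i j :=
    (Continuous.matrix_adjugate (continuous_id (X := Matrix κ κ ℝ))).matrix_elem i j
  have h := ((hdet.measurable.comp hM').inv).mul (hadj.measurable.comp hM')
  convert h using 2 with s
  rw [Matrix.inv_def, Matrix.smul_apply, Ring.inverse_eq_inv', smul_eq_mul]
  rfl

theorem measurableSet_isUnit_det {M : S → Matrix κ κ ℝ}
    (hM : ∀ i j, Measurable fun s => M s i j) : MeasurableSet {s | IsUnit (M s).det} := by
  have hm : Measurable fun s => (M s).det := by
    simp only [Matrix.det_apply]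
    exact Finset.measurable_fun_sum _ fun σ _ => (Finset.measurable_fun_prod _ fun i _ =>
      hM _ _).const_smul _
  simp only [isUnit_iff_ne_zero]
  exact (measurableSet_eq_fun hm measurable_const).compl

theorem tendsto_matrix_mul {l m n : Type*} [Fintype m] {M : ℕ → Matrix l m ℝ} {M₀ : Matrix l m ℝ}
    {N : ℕ → Matrix m n ℝ} {N₀ : Matrix m n ℝ} (hM : Tendsto M atTop (𝓝 M₀))
    (hN : Tendsto N atTop (𝓝 N₀)) : Tendsto (fun k => M k * N k) atTop (𝓝 (M₀ * N₀)) :=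
  ((continuous_fst.matrix_mul continuous_snd).tendsto (M₀, N₀)).comp (hM.prodMk_nhds hN)

theorem tendsto_matrix_inv {M : ℕ → Matrix κ κ ℝ} {M₀ : Matrix κ κ ℝ}
    (hM : Tendsto M atTop (𝓝 M₀)) (hdet : IsUnit M₀.det) :
    Tendsto (fun n => (M n)⁻¹) atTop (𝓝 M₀⁻¹) := by
  simp only [Matrix.inv_def, Ring.inverse_eq_inv']
  have h1 : Tendsto (fun n => (M n).det) atTop (𝓝 M₀.det) :=
    ((continuous_id (X := Matrix κ κ ℝ)).matrix_det.tendsto M₀).comp hM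
  have h2 : Tendsto (fun n => (M n).adjugate) atTop (𝓝 M₀.adjugate) :=
    ((continuous_id (X := Matrix κ κ ℝ)).matrix_adjugate.tendsto M₀).comp hM
  exact (h1.inv₀ hdet.ne_zero).smul h2

theorem eventually_isUnit_det {M : ℕ → Matrix κ κ ℝ} {M₀ : Matrix κ κ ℝ}
    (hM : Tendsto M atTop (𝓝 M₀)) (hdet : IsUnit M₀.det) : ∀ᶠ n in atTop, IsUnit (M n).det := by
  have h1 : Tendsto (fun n => (M n).det) atTop (𝓝 M₀.det) :=
    ((continuous_id (X := Matrix κ κ ℝ)).matrix_det.tendsto M₀).comp hM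
  filter_upwards [h1.eventually_ne hdet.ne_zero] with n hn using hn.isUnit

end Probability

/-! ### Estimators solving a linear combination of moment conditions -/

section LinearMomentEstimators

variable {S : Type*} {p : ℕ} {ι : Type*}

/-- The matrix whose columns are the instruments `z (X_0), …, z (X_{n-1})`; `ι` indexes the
moment conditions. -/
def dataZ (z : (Fin p → ℝ) → ι → ℝ) (X : ℕ → S → Fin p → ℝ) (n : ℕ) (s : S) :
    Matrix ι (Fin n) ℝ :=
  Matrix.of fun a i => z (X i s) a

/-- The sample average `n⁻¹ Z X'` of `z(X_i) X_i'`. Up to sign, it is the Jacobian of the sample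
moments in the parameter. It is zero for `n = 0`. -/
noncomputable def sampleJac (z : (Fin p → ℝ) → ι → ℝ) (X : ℕ → S → Fin p → ℝ) (n : ℕ) (s : S) :
    Matrix ι (Fin p) ℝ :=
  (n : ℝ)⁻¹ • (dataZ z X n s * (dataX X n s)ᵀ)

theorem dataY_eq {X : ℕ → S → Fin p → ℝ} {Y ε : ℕ → S → ℝ} {β : Fin p → ℝ}
    (hmodel : ∀ i s, Y i s = X i s ⬝ᵥ β + ε i s) (n : ℕ) (s : S) :
    dataY Y n s = (dataX X n s)ᵀ *ᵥ β + dataY ε n s := by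
  ext i
  simp [dataY, dataX, hmodel, Matrix.mulVec, dotProduct]

theorem gls_normal_matrix_eq [Fintype ι] {z : (Fin p → ℝ) → ι → ℝ} {X : ℕ → S → Fin p → ℝ} {n : ℕ} {s : S}
    {B : Matrix (Fin n) (Fin n) ℝ} {K : Matrix (Fin p) ι ℝ}
    (hB : dataX X n s * B = K * dataZ z X n s) :
    K * sampleJac z X n s = (n : ℝ)⁻¹ • (dataX X n s * B * (dataX X n s)ᵀ) := by
  rw [sampleJac, Matrix.mul_smul, hB, Matrix.mul_assoc]

variable [MeasurableSpace S]

theorem measurable_mul_apply {l m n : Type*} [Fintype m] {M : S → Matrix l m ℝ}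
    {N : S → Matrix m n ℝ} (hM : ∀ i j, Measurable fun s => M s i j)
    (hN : ∀ i j, Measurable fun s => N s i j) (i : l) (j : n) :
    Measurable fun s => (M s * N s) i j := by
  simp only [Matrix.mul_apply]
  exact Finset.measurable_fun_sum _ fun k _ => (hM i k).mul (hN k j)

theorem measurable_mulVec_apply {l m : Type*} [Fintype m] {M : S → Matrix l m ℝ}
    {v : S → m → ℝ} (hM : ∀ i j, Measurable fun s => M s i j)
    (hv : ∀ i, Measurable fun s => v s i) (i : l) :
    Measurable fun s => (M s *ᵥ v s) i := by
  simp only [Matrix.mulVec, dotProduct]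
  exact Finset.measurable_fun_sum _ fun k _ => (hM i k).mul (hv k)

theorem measurable_dataX {X : ℕ → S → Fin p → ℝ} (hX : ∀ i, Measurable (X i)) (n : ℕ) (j : Fin p)
    (i : Fin n) : Measurable fun s => dataX X n s j i :=
  (measurable_pi_apply j).comp (hX i)

theorem measurable_dataZ {z : (Fin p → ℝ) → ι → ℝ} (hz : Measurable z) {X : ℕ → S → Fin p → ℝ}
    (hX : ∀ i, Measurable (X i)) (n : ℕ) (a : ι) (i : Fin n) :
    Measurable fun s => dataZ z X n s a i :=
  (measurable_pi_apply a).comp (hz.comp (hX i))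

theorem measurable_sampleJac {z : (Fin p → ℝ) → ι → ℝ} (hz : Measurable z)
    {X : ℕ → S → Fin p → ℝ} (hX : ∀ i, Measurable (X i)) (n : ℕ) (a : ι) (j : Fin p) :
    Measurable fun s => sampleJac z X n s a j :=
  (measurable_mul_apply (measurable_dataZ hz hX n) (fun i j => measurable_dataX hX n j i)
    a j).const_mul _

variable [Fintype ι]

/-- Only the product `X B` enters the estimator, so no measurability of `B` itself is needed. -/
theorem measurable_glsEstimator {z : (Fin p → ℝ) → ι → ℝ} (hz : Measurable z)
    {X : ℕ → S → Fin p → ℝ} {Y : ℕ → S → ℝ} (hX : ∀ i, Measurable (X i))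
    (hY : ∀ i, Measurable (Y i)) {n : ℕ} {B : S → Matrix (Fin n) (Fin n) ℝ}
    {K : S → Matrix (Fin p) ι ℝ} (hK : ∀ j a, Measurable fun s => K s j a)
    (hB : ∀ s, dataX X n s * B s = K s * dataZ z X n s) :
    Measurable fun s => glsEstimator (B s) (dataX X n s) (dataY Y n s) := by
  have hXB : ∀ j i, Measurable fun s => (dataX X n s * B s) j i := by
    simp only [hB]
    exact measurable_mul_apply hK (measurable_dataZ hz hX n)
  refine measurable_pi_iff.2 fun j => ?_
  exact measurable_mulVec_apply
    (measurable_inv_apply (measurable_mul_apply hXB fun i j => measurable_dataX hX n j i))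
    (measurable_mulVec_apply hXB fun i => hY i) j

variable {P : Measure S} [IsProbabilityMeasure P]

theorem tendsto_measure_isUnit_det {z : (Fin p → ℝ) → ι → ℝ} (hz : Measurable z)
    {X : ℕ → S → Fin p → ℝ} (hX : ∀ i, Measurable (X i)) {G : Matrix ι (Fin p) ℝ}
    (hG : ∀ᵐ s ∂P, Tendsto (fun n => sampleJac z X n s) atTop (𝓝 G))
    {K : ℕ → S → Matrix (Fin p) ι ℝ} {K₀ : Matrix (Fin p) ι ℝ}
    (hKm : ∀ n j a, Measurable fun s => K n s j a)
    (hK : ∀ᵐ s ∂P, Tendsto (fun n => K n s) atTop (𝓝 K₀)) (hdet : IsUnit (K₀ * G).det) :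
    Tendsto (fun n => P {s | IsUnit (K n s * sampleJac z X n s).det}) atTop (𝓝 1) := by
  refine tendsto_measure_one_of_ae_eventually (fun n => ?_) ?_
  · exact measurableSet_isUnit_det (measurable_mul_apply (hKm n) (measurable_sampleJac hz hX n))
  · filter_upwards [hG, hK] with s hGs hKs
    exact eventually_isUnit_det (tendsto_matrix_mul hKs hGs) hdet

theorem tendsto_measure_isUnit_normal_matrix {z : (Fin p → ℝ) → ι → ℝ} (hz : Measurable z)
    {X : ℕ → S → Fin p → ℝ} (hX : ∀ i, Measurable (X i)) {G : Matrix ι (Fin p) ℝ}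
    (hG : ∀ᵐ s ∂P, Tendsto (fun n => sampleJac z X n s) atTop (𝓝 G))
    {B : (n : ℕ) → S → Matrix (Fin n) (Fin n) ℝ}
    {K : ℕ → S → Matrix (Fin p) ι ℝ} {K₀ : Matrix (Fin p) ι ℝ}
    (hKm : ∀ n j a, Measurable fun s => K n s j a)
    (hK : ∀ᵐ s ∂P, Tendsto (fun n => K n s) atTop (𝓝 K₀)) (hdet : IsUnit (K₀ * G).det)
    (hB : ∀ n s, dataX X n s * B n s = K n s * dataZ z X n s) :
    Tendsto (fun n => P {s | IsUnit (dataX X n s * B n s * (dataX X n s)ᵀ).det}) atTop (𝓝 1) := by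
  refine (tendsto_measure_isUnit_det hz hX hG hKm hK hdet).congr' ?_
  filter_upwards [eventually_ne_atTop 0] with n hn
  congr 1
  ext s
  have hn' : ((n : ℝ)⁻¹) ^ p ≠ 0 := by positivity
  simp only [Set.mem_ofPred_eq]
  rw [gls_normal_matrix_eq (hB n s), Matrix.det_smul, Fintype.card_fin, isUnit_iff_ne_zero,
    isUnit_iff_ne_zero, mul_ne_zero_iff, and_iff_right hn']

theorem tendsto_measure_compl_zero {A : ℕ → Set S} (hA : ∀ n, MeasurableSet (A n))
    (h : Tendsto (fun n => P (A n)) atTop (𝓝 1)) : Tendsto (fun n => P (A n)ᶜ) atTop (𝓝 0) := by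
  simp only [fun n => prob_compl_eq_one_sub (μ := P) (hA n)]
  simpa using ENNReal.Tendsto.sub tendsto_const_nhds h (Or.inl ENNReal.one_ne_top)

/-- Estimators that agree with probability tending to one have the same asymptotic distribution. -/
theorem AsymptoticallyNormal.congr {b b' : ℕ → S → Fin p → ℝ} {β : Fin p → ℝ}
    {V : Matrix (Fin p) (Fin p) ℝ} (hb : AsymptoticallyNormal P b β V)
    (hb' : ∀ n, AEMeasurable (b' n) P)
    (hne : Tendsto (fun n => P {s | b' n s ≠ b n s}) atTop (𝓝 0)) :
    AsymptoticallyNormal P b' β V := by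
  refine ⟨hb.1, tendstoInDistribution_of_tendsto_measure_ne hb.2 (fun n => ?_) ?_⟩
  · exact (WithLp.measurable_toLp 2 _).comp_aemeasurable
      (((hb' n).sub_const β).const_smul (√(n : ℝ)))
  · refine tendsto_of_tendsto_of_tendsto_of_le_of_le tendsto_const_nhds hne
      (fun _ => bot_le) fun n => measure_mono fun s hs => ?_
    simp only [Set.mem_ofPred_eq] at hs ⊢
    exact fun h => hs (by rw [h])

/-- Asymptotic normality of the GLS estimators that solve a linear combination `K_n` of the moment
conditions, where the selection matrix `K_n` may depend on the data and converges almost surely. -/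
theorem asymptoticallyNormal_glsEstimator [DecidableEq ι] {z : (Fin p → ℝ) → ι → ℝ} (hz : Measurable z)
    {X : ℕ → S → Fin p → ℝ} {Y ε : ℕ → S → ℝ} {β : Fin p → ℝ} (hX : ∀ i, Measurable (X i))
    (hY : ∀ i, Measurable (Y i)) (hmodel : ∀ i s, Y i s = X i s ⬝ᵥ β + ε i s)
    {Ω : Matrix ι ι ℝ} (hΩ : Ω.PosSemidef)
    (hclt : TendstoInDistribution
      (fun (n : ℕ) (s : S) => (WithLp.toLp 2 ((√(n : ℝ))⁻¹ •
        ∑ i ∈ Finset.range n, ε i s • z (X i s)) : EuclideanSpace ℝ ι))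
      atTop (id : EuclideanSpace ℝ ι → EuclideanSpace ℝ ι) (fun _ => P)
      (multivariateGaussian 0 Ω))
    {G : Matrix ι (Fin p) ℝ}
    (hG : ∀ᵐ s ∂P, Tendsto (fun n => sampleJac z X n s) atTop (𝓝 G))
    {B : (n : ℕ) → S → Matrix (Fin n) (Fin n) ℝ}
    {K : ℕ → S → Matrix (Fin p) ι ℝ} {K₀ : Matrix (Fin p) ι ℝ}
    (hKm : ∀ n j a, Measurable fun s => K n s j a)
    (hK : ∀ᵐ s ∂P, Tendsto (fun n => K n s) atTop (𝓝 K₀)) (hdet : IsUnit (K₀ * G).det)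
    (hB : ∀ n s, dataX X n s * B n s = K n s * dataZ z X n s) :
    AsymptoticallyNormal P
      (fun n s => glsEstimator (B n s) (dataX X n s) (dataY Y n s)) β
      (((K₀ * G)⁻¹ * K₀) * Ω * ((K₀ * G)⁻¹ * K₀)ᵀ) := by
  have hV : (((K₀ * G)⁻¹ * K₀) * Ω * ((K₀ * G)⁻¹ * K₀)ᵀ).PosSemidef := by
    rw [← conjTranspose_eq_transpose_of_trivial]; exact hΩ.mul_mul_conjTranspose_same _
  have hKG : ∀ n j k, Measurable fun s => (K n s * sampleJac z X n s) j k :=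
    fun n => measurable_mul_apply (hKm n) (measurable_sampleJac hz hX n)
  have hlin := tendstoInDistribution_mulVec hΩ hclt
    (H := fun n s => (K n s * sampleJac z X n s)⁻¹ * K n s) (H₀ := (K₀ * G)⁻¹ * K₀)
    (fun n => measurable_mul_apply (measurable_inv_apply (hKG n)) (hKm n)) (by
      filter_upwards [hG, hK] with s hGs hKs
      exact tendsto_matrix_mul (tendsto_matrix_inv (tendsto_matrix_mul hKs hGs) hdet) hKs)
  refine ⟨hV, tendstoInDistribution_of_tendsto_measure_ne hlin (fun n => ?_) ?_⟩
  · exact (WithLp.measurable_toLp 2 _).comp_aemeasurable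
      (((measurable_glsEstimator hz hX hY (hKm n) (hB n)).sub_const β).const_smul
        (√(n : ℝ))).aemeasurable
  · have hm : ∀ n, MeasurableSet {s | IsUnit (K n s * sampleJac z X n s).det} :=
      fun n => measurableSet_isUnit_det (hKG n)
    have h0 := tendsto_measure_compl_zero hm (tendsto_measure_isUnit_det hz hX hG hKm hK hdet)
    refine tendsto_of_tendsto_of_tendsto_of_le_of_le' tendsto_const_nhds h0
      (Eventually.of_forall fun _ => bot_le) ?_
    filter_upwards [eventually_ne_atTop 0] with n hn
    refine measure_mono fun s hs hu => hs ?_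
    simp only [Set.mem_ofPred_eq] at hu
    have hn' : (n : ℝ)⁻¹ ≠ 0 := by positivity
    rw [dataY_eq hmodel, glsEstimator_sub (hB n s) β _ hn' hu, ← Matrix.mulVec_smul]
    congr 2
    ext a
    -- `√n` times a sample average is the CLT normalization of the sum
    have hsq : √(n : ℝ) * (n : ℝ)⁻¹ = (√(n : ℝ))⁻¹ := by
      have : √(n : ℝ) ≠ 0 := by positivity
      field_simp
      exact Real.sq_sqrt (by positivity)
    simp only [Pi.smul_apply, smul_eq_mul, Finset.sum_apply, Matrix.mulVec, dotProduct]
    rw [← mul_assoc, hsq, Finset.sum_range]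
    congr 1
    exact Finset.sum_congr rfl fun i _ => mul_comm _ _

end LinearMomentEstimators

/-! ### Population second-moment matrices and exogeneity -/

section Population

variable {S : Type*} [MeasurableSpace S] {P : Measure S} {p : ℕ}

/-- A vector in the kernel of `E[w x x']`, for a positive weight `w`, is almost surely orthogonal
to `x`: `0 = v' E[w x x'] v = E[(√w v' x)²]`. -/
theorem ae_dotProduct_eq_zero {w : S → ℝ} {x : S → Fin p → ℝ} (hw : Measurable w)
    (hw_pos : ∀ s, 0 < w s) (hx : Measurable x) (hfin : FiniteMoments P w x) {v : Fin p → ℝ}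
    (hv : momentMatrix P w x *ᵥ v = 0) : ∀ᵐ s ∂P, v ⬝ᵥ x s = 0 := by
  have hsq : ∀ s j k, √(w s) * x s j * (√(w s) * x s k) = w s * x s j * x s k := by
    intro s j k
    linear_combination (x s j * x s k) * Real.mul_self_sqrt (hw_pos s).le
  have hL2 : ∀ j, MemLp (fun s => (√(w s) • x s) j) 2 P := fun j => by
    have hm : Measurable fun s => (√(w s) • x s) j :=
      hw.sqrt.mul ((measurable_pi_apply j).comp hx)
    refine (memLp_two_iff_integrable_sq hm.aestronglyMeasurable).2 ?_
    simpa only [Pi.smul_apply, smul_eq_mul, sq, hsq] using hfin j j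
  have hint := integral_dotProduct_sq hL2 (Ω := momentMatrix P w x) (fun j k => by
    simp only [Pi.smul_apply, smul_eq_mul, hsq, momentMatrix, Matrix.of_apply]) v
  rw [hv, dotProduct_zero] at hint
  have hmem : MemLp (fun s => v ⬝ᵥ (√(w s) • x s)) 2 P := by
    simp only [dotProduct]
    exact memLp_finsetSum _ fun j _ => (hL2 j).const_mul _
  rw [integral_eq_zero_iff_of_nonneg (fun s => sq_nonneg _) hmem.integrable_sq] at hint
  filter_upwards [hint] with s hs
  have hs' : v ⬝ᵥ (√(w s) • x s) = 0 := by simpa using hs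
  rw [dotProduct_smul, smul_eq_mul] at hs'
  exact (mul_eq_zero.1 hs').resolve_left (Real.sqrt_pos.2 (hw_pos s)).ne'

theorem momentMatrix_mulVec_eq_zero {w : S → ℝ} {x : S → Fin p → ℝ} (hfin : FiniteMoments P w x)
    {v : Fin p → ℝ} (hv : ∀ᵐ s ∂P, v ⬝ᵥ x s = 0) : momentMatrix P w x *ᵥ v = 0 := by
  ext j
  simp only [Matrix.mulVec, dotProduct, momentMatrix, Matrix.of_apply, Pi.zero_apply]
  simp only [← integral_mul_const]
  rw [← integral_finsetSum _ fun k _ => (hfin j k).mul_const _]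
  refine integral_eq_zero_of_ae ?_
  filter_upwards [hv] with s hs
  rw [Pi.zero_apply, ← mul_zero (w s * x s j), ← hs, dotProduct, Finset.mul_sum]
  exact Finset.sum_congr rfl fun k _ => by ring

theorem isUnit_det_of_mulVec {M : Matrix (Fin p) (Fin p) ℝ} (h : ∀ v, M *ᵥ v = 0 → v = 0) :
    IsUnit M.det := by
  rw [isUnit_iff_ne_zero]
  intro h0
  obtain ⟨v, hv, hMv⟩ := Matrix.exists_mulVec_eq_zero_iff.2 h0
  exact hv (h v hMv)

theorem mulVec_injective_of_rank {m : Type*} [Fintype m] {G : Matrix m (Fin p) ℝ}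
    (hG : G.rank = p) : Function.Injective G.mulVec := by
  have h := LinearMap.finrank_range_add_finrank_ker G.mulVecLin
  rw [← Matrix.rank, hG, Module.finrank_fin_fun] at h
  have hk : LinearMap.ker G.mulVecLin = ⊥ := Submodule.finrank_eq_zero.1 (by omega)
  exact LinearMap.ker_eq_bot.1 hk

theorem isSymm_momentMatrix (w : S → ℝ) (x : S → Fin p → ℝ) : (momentMatrix P w x).IsSymm := by
  ext j k
  simp only [Matrix.transpose_apply, momentMatrix, Matrix.of_apply]
  exact integral_congr_ae (ae_of_all _ fun s => by ring)

/-- Exogeneity makes the error orthogonal to every function of the regressors. -/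
theorem integral_comp_mul_eq_zero [IsProbabilityMeasure P] {E : Type*} [MeasurableSpace E]
    {x : S → E} (hx : Measurable x) {e : S → ℝ} (he : Integrable e P)
    (hexog : P[e | MeasurableSpace.comap x inferInstance] =ᵐ[P] 0) {f : E → ℝ}
    (hf : Measurable f) (hfe : Integrable (fun s => f (x s) * e s) P) :
    ∫ s, f (x s) * e s ∂P = 0 := by
  have hsm : StronglyMeasurable[MeasurableSpace.comap x inferInstance] fun s => f (x s) :=
    (hf.comp (comap_measurable x)).stronglyMeasurable
  have h := condExp_mul_of_stronglyMeasurable_left hsm hfe he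
  rw [← integral_condExp hx.comap_le]
  refine integral_eq_zero_of_ae ?_
  refine EventuallyEq.trans h ?_
  filter_upwards [hexog] with s hs
  simp [hs]

end Population

/-! ### The joint OLS and WLS moments -/

section Instruments

variable {S : Type*} [MeasurableSpace S] {P : Measure S} {p : ℕ}

/-- The joint instruments `(x, x / σ²(x))`: multiplied by the error they give the OLS and the WLS
moments. -/
noncomputable def instrument (sigmaSq : (Fin p → ℝ) → ℝ) (x : Fin p → ℝ) : Fin p ⊕ Fin p → ℝ :=
  Sum.elim x fun j => x j / sigmaSq x

theorem measurable_instrument {sigmaSq : (Fin p → ℝ) → ℝ} (hσ : Measurable sigmaSq) :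
    Measurable (instrument sigmaSq) := by
  refine measurable_pi_iff.2 fun a => ?_
  rcases a with j | j
  · exact measurable_pi_apply j
  · exact (measurable_pi_apply j).div hσ

theorem stack_data_eq {S : Type*} (sigmaSq : (Fin p → ℝ) → ℝ) (X : ℕ → S → Fin p → ℝ) (n : ℕ) (s : S) :
    stack (dataX X n s) (dataD sigmaSq X n s) = dataZ (instrument sigmaSq) X n s := by
  ext a i
  rcases a with j | j
  · simp [stack, dataX, dataZ, instrument]
  · simp [stack, dataX, dataZ, dataD, instrument, Matrix.mul_diagonal, div_eq_mul_inv]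

theorem integrable_instrument_mul {sigmaSq : (Fin p → ℝ) → ℝ} {x : S → Fin p → ℝ}
    (h₁ : FiniteMoments P (fun _ => 1) x) (h₂ : FiniteMoments P (fun s => 1 / sigmaSq (x s)) x)
    (a : Fin p ⊕ Fin p) (k : Fin p) :
    Integrable (fun s => instrument sigmaSq (x s) a * x s k) P := by
  rcases a with j | j
  · refine (h₁ j k).congr (ae_of_all _ fun s => ?_)
    simp [instrument]
  · refine (h₂ j k).congr (ae_of_all _ fun s => ?_)
    simp only [instrument, Sum.elim_inr]; ring

theorem integral_instrument_mul (sigmaSq : (Fin p → ℝ) → ℝ) (x : S → Fin p → ℝ)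
    (a : Fin p ⊕ Fin p) (k : Fin p) :
    ∫ s, instrument sigmaSq (x s) a * x s k ∂P = jac P sigmaSq x a k := by
  rcases a with j | j
  · simp [jac, jacOLS, momentMatrix, instrument]
  · simp only [jac, jacWLS, momentMatrix, instrument, Sum.elim_inr, Matrix.fromRows_apply_inr,
      Matrix.of_apply]
    exact integral_congr_ae (ae_of_all _ fun s => by ring)

theorem integral_moment_mul_moment (sigmaSq : (Fin p → ℝ) → ℝ) (x : S → Fin p → ℝ) (e : S → ℝ)
    (a b : Fin p ⊕ Fin p) :
    ∫ s, (e s • instrument sigmaSq (x s)) a * (e s • instrument sigmaSq (x s)) b ∂P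
      = momentCov P sigmaSq x e a b := by
  rcases a with j | j <;> rcases b with k | k <;>
  · simp only [momentCov, covOLS, covCross, covWLS, momentMatrix, instrument, Pi.smul_apply,
      smul_eq_mul, Sum.elim_inl, Sum.elim_inr, Matrix.fromBlocks_apply₁₁,
      Matrix.fromBlocks_apply₁₂, Matrix.fromBlocks_apply₂₁, Matrix.fromBlocks_apply₂₂,
      Matrix.of_apply]
    exact integral_congr_ae (ae_of_all _ fun s => by ring)

theorem memLp_moment {sigmaSq : (Fin p → ℝ) → ℝ} (hσ : Measurable sigmaSq) {x : S → Fin p → ℝ}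
    (hx : Measurable x) {e : S → ℝ} (he : Measurable e)
    (h₁₁ : FiniteMoments P (fun s => e s ^ 2) x)
    (h₂₂ : FiniteMoments P (fun s => e s ^ 2 / sigmaSq (x s) ^ 2) x) (a : Fin p ⊕ Fin p) :
    MemLp (fun s => (e s • instrument sigmaSq (x s)) a) 2 P := by
  have hm : Measurable fun s => (e s • instrument sigmaSq (x s)) a :=
    he.mul ((measurable_pi_apply a).comp ((measurable_instrument hσ).comp hx))
  refine (memLp_two_iff_integrable_sq hm.aestronglyMeasurable).2 ?_
  rcases a with j | j
  · refine (h₁₁ j j).congr (ae_of_all _ fun s => ?_)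
    simp only [instrument, Pi.smul_apply, smul_eq_mul, Sum.elim_inl]; ring
  · refine (h₂₂ j j).congr (ae_of_all _ fun s => ?_)
    simp only [instrument, Pi.smul_apply, smul_eq_mul, Sum.elim_inr]; ring

end Instruments

/-! ### Limits of the joint moments and their Jacobian -/

section JointMoments

theorem tendsto_sampleJac {S : Type*} [MeasurableSpace S] {P : Measure S} {p : ℕ}
    {X : ℕ → S → Fin p → ℝ} {sigmaSq : (Fin p → ℝ) → ℝ} (hσ : Measurable sigmaSq)
    (hindep : iIndepFun X P) (hident : ∀ i, IdentDistrib (X i) (X 0) P P)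
    (h₁ : FiniteMoments P (fun _ => 1) (X 0))
    (h₂ : FiniteMoments P (fun s => 1 / sigmaSq (X 0 s)) (X 0)) :
    ∀ᵐ s ∂P, Tendsto (fun n => sampleJac (instrument sigmaSq) X n s) atTop
      (𝓝 (jac P sigmaSq (X 0))) := by
  have hmeas : ∀ a k, Measurable fun x : Fin p → ℝ => instrument sigmaSq x a * x k := fun a k =>
    ((measurable_pi_apply a).comp (measurable_instrument hσ)).mul (measurable_pi_apply k)
  have h : ∀ a k, ∀ᵐ s ∂P, Tendsto (fun n : ℕ => (n : ℝ)⁻¹ *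
      ∑ i ∈ Finset.range n, instrument sigmaSq (X i s) a * X i s k) atTop
      (𝓝 (jac P sigmaSq (X 0) a k)) := fun a k => by
    rw [← integral_instrument_mul]
    exact tendsto_average_ae (f := fun i s => instrument sigmaSq (X i s) a * X i s k)
      (integrable_instrument_mul h₁ h₂ a k)
      (hindep.comp (fun _ x => instrument sigmaSq x a * x k) fun _ => hmeas a k)
      fun i => (hident i).comp (hmeas a k)
  filter_upwards [ae_all_iff.2 fun a => ae_all_iff.2 fun k => h a k] with s hs
  refine tendsto_pi_nhds.2 fun a => tendsto_pi_nhds.2 fun k => (hs a k).congr fun n => ?_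
  simp only [sampleJac, Matrix.smul_apply, Matrix.mul_apply, smul_eq_mul, dataZ, dataX,
    Matrix.transpose_apply, Matrix.of_apply]
  rw [Finset.sum_range]

/-- Full rank of the stacked Jacobian makes every positively weighted second-moment matrix
invertible, since the kernel of one such matrix is contained in the kernels of all others. -/
theorem isUnit_det_momentMatrix_of_rank {S : Type*} [MeasurableSpace S] {P : Measure S} {p : ℕ}
    {x : S → Fin p → ℝ} {sigmaSq : (Fin p → ℝ) → ℝ} (hx : Measurable x)
    (h₁ : FiniteMoments P (fun _ => 1) x) (h₂ : FiniteMoments P (fun s => 1 / sigmaSq (x s)) x)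
    (hrank : (jac P sigmaSq x).rank = p) {w : S → ℝ} (hw : Measurable w) (hw_pos : ∀ s, 0 < w s)
    (hfin : FiniteMoments P w x) : IsUnit (momentMatrix P w x).det := by
  refine isUnit_det_of_mulVec fun v hv => ?_
  have h0 := ae_dotProduct_eq_zero hw hw_pos hx hfin hv
  refine mulVec_injective_of_rank hrank ?_
  rw [Matrix.mulVec_zero, jac, Matrix.fromRows_mulVec, jacOLS, jacWLS,
    momentMatrix_mulVec_eq_zero h₁ h0, momentMatrix_mulVec_eq_zero h₂ h0]
  ext a
  rcases a with j | j <;> rfl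

/-- The normalized sum of the joint moments `ε_i z(X_i)` tends to `N(0, Ω)`. -/
theorem tendstoInDistribution_moment {S : Type*} [MeasurableSpace S] {P : Measure S}
    [IsProbabilityMeasure P] {p : ℕ} {X : ℕ → S → Fin p → ℝ} {ε : ℕ → S → ℝ}
    {sigmaSq : (Fin p → ℝ) → ℝ} (hσ : Measurable sigmaSq)
    (hX : Measurable (X 0)) (hεm : Measurable (ε 0)) (hε : Integrable (ε 0) P)
    (hexog : P[ε 0 | MeasurableSpace.comap (X 0) inferInstance] =ᵐ[P] 0)
    (hindep : iIndepFun (fun i s => (X i s, ε i s)) P)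
    (hident : ∀ i, IdentDistrib (fun s => (X i s, ε i s)) (fun s => (X 0 s, ε 0 s)) P P)
    (h₁₁ : FiniteMoments P (fun s => ε 0 s ^ 2) (X 0))
    (h₂₂ : FiniteMoments P (fun s => ε 0 s ^ 2 / sigmaSq (X 0 s) ^ 2) (X 0)) :
    TendstoInDistribution
      (fun (n : ℕ) (s : S) => (WithLp.toLp 2 ((√(n : ℝ))⁻¹ •
        ∑ i ∈ Finset.range n, ε i s • instrument sigmaSq (X i s)) :
          EuclideanSpace ℝ (Fin p ⊕ Fin p)))
      atTop (id : EuclideanSpace ℝ (Fin p ⊕ Fin p) → EuclideanSpace ℝ (Fin p ⊕ Fin p))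
      (fun _ => P) (multivariateGaussian 0 (momentCov P sigmaSq (X 0) (ε 0))) := by
  have hz := measurable_instrument (p := p) hσ
  have hL2 := memLp_moment hσ hX hεm h₁₁ h₂₂
  have hφ : Measurable fun q : (Fin p → ℝ) × ℝ => q.2 • instrument sigmaSq q.1 :=
    measurable_snd.smul (hz.comp measurable_fst)
  refine tendstoInDistribution_multivariateGaussian
    (ξ := fun i s => ε i s • instrument sigmaSq (X i s)) hL2 (fun a => ?_)
    (hindep.comp (fun _ q => q.2 • instrument sigmaSq q.1) fun _ => hφ)
    (fun i => (hident i).comp hφ) (integral_moment_mul_moment sigmaSq (X 0) (ε 0))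
  have hcomm : ∀ s, (ε 0 s • instrument sigmaSq (X 0 s)) a
      = instrument sigmaSq (X 0 s) a * ε 0 s := fun s => by
    rw [Pi.smul_apply, smul_eq_mul, mul_comm]
  have hint := (hL2 a).integrable (by norm_num)
  simp only [hcomm] at hint ⊢
  exact integral_comp_mul_eq_zero hX hε hexog ((measurable_pi_apply a).comp hz) hint

/-- The sandwich covariance of an estimator that selects the moments with Jacobian `J` and
covariance `C`. -/
theorem selection_sandwich {p : ℕ} {J C : Matrix (Fin p) (Fin p) ℝ} (hJ : J.IsSymm)
    {ι : Type*} [Fintype ι] {K : Matrix (Fin p) ι ℝ} {G : Matrix ι (Fin p) ℝ} {Ω : Matrix ι ι ℝ}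
    (hKG : K * G = J) (hKΩ : K * Ω * Kᵀ = C) :
    ((K * G)⁻¹ * K) * Ω * ((K * G)⁻¹ * K)ᵀ = J⁻¹ * C * J⁻¹ := by
  rw [hKG, Matrix.transpose_mul, Matrix.transpose_nonsing_inv, hJ.eq, ← hKΩ]
  simp only [Matrix.mul_assoc]

end JointMoments

end GALS

/-! ### Closed form, asymptotic normality and efficiency of GALS -/

theorem theorem1 {S : Type*} [MeasurableSpace S] (P : Measure S) [IsProbabilityMeasure P]
    {p : ℕ} (X : ℕ → S → Fin p → ℝ) (Y ε : ℕ → S → ℝ) (β : Fin p → ℝ)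
    (sigmaSq : (Fin p → ℝ) → ℝ)
    -- linear model with exogenous regressors
    (hX : ∀ i, Measurable (X i)) (hY : ∀ i, Measurable (Y i))
    (hmodel : ∀ i s, Y i s = X i s ⬝ᵥ β + ε i s)
    (hε : ∀ i, Integrable (ε i) P)
    (hexog : ∀ i, P[ε i | MeasurableSpace.comap (X i) inferInstance] =ᵐ[P] 0)
    -- i.i.d. data
    (hindep : iIndepFun (fun i s => (X i s, Y i s)) P)
    (hident : ∀ i, IdentDistrib (fun s => (X i s, Y i s)) (fun s => (X 0 s, Y 0 s)) P P)
    -- the (possibly misspecified) variance model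
    (hσ_meas : Measurable sigmaSq) (hσ_pos : ∀ x, 0 < sigmaSq x)
    -- the matrix `G` exists and has full rank
    (hG₁ : GALS.FiniteMoments P (fun _ => 1) (X 0))
    (hG₂ : GALS.FiniteMoments P (fun s => 1 / sigmaSq (X 0 s)) (X 0))
    (G : Matrix (Fin p ⊕ Fin p) (Fin p) ℝ) (hG : G = GALS.jac P sigmaSq (X 0))
    (hG_rank : G.rank = p)
    -- the matrix `Ω` exists and is non-degenerate
    (hΩ₁₁ : GALS.FiniteMoments P (fun s => ε 0 s ^ 2) (X 0))
    (hΩ₁₂ : GALS.FiniteMoments P (fun s => ε 0 s ^ 2 / sigmaSq (X 0 s)) (X 0))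
    (hΩ₂₂ : GALS.FiniteMoments P (fun s => ε 0 s ^ 2 / sigmaSq (X 0 s) ^ 2) (X 0))
    (Ω W : Matrix (Fin p ⊕ Fin p) (Fin p ⊕ Fin p) ℝ)
    (hΩ : Ω = GALS.momentCov P sigmaSq (X 0) (ε 0)) (hΩ_det : IsUnit Ω.det) (hW : W = Ω⁻¹)
    -- the random matrix `A_n`
    (A : (n : ℕ) → S → Matrix (Fin n) (Fin n) ℝ)
    (hA : ∀ n s, A n s = GALS.galsMatrix W (GALS.dataX X n s) (GALS.dataD sigmaSq X n s)) :
    -- the optimally weighted GMM estimator is the GLS estimator with symmetric matrix `A_n`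
    (∀ n s,
      (A n s).IsSymm ∧
      (∀ b, GALS.gmmCriterion W (GALS.dataX X n s) (GALS.dataD sigmaSq X n s)
          (GALS.dataY Y n s) b
        = GALS.glsCriterion (A n s) (GALS.dataX X n s) (GALS.dataY Y n s) b) ∧
      (IsUnit (GALS.dataX X n s * A n s * (GALS.dataX X n s)ᵀ).det →
        ∀ b, GALS.IsGMMEstimator W (GALS.dataX X n s) (GALS.dataD sigmaSq X n s)
            (GALS.dataY Y n s) b
          ↔ b = GALS.glsEstimator (A n s) (GALS.dataX X n s) (GALS.dataY Y n s))) ∧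
    Tendsto (fun n : ℕ => P {s | IsUnit (GALS.dataX X n s * A n s * (GALS.dataX X n s)ᵀ).det})
      atTop (𝓝 1) ∧
    -- asymptotic normality of GALS: for the closed form, and for every choice of minimizers
    (Gᵀ * W * G).PosDef ∧
    GALS.AsymptoticallyNormal P
      (fun n s => GALS.glsEstimator (A n s) (GALS.dataX X n s) (GALS.dataY Y n s))
      β (Gᵀ * W * G)⁻¹ ∧
    (∀ b : ℕ → S → Fin p → ℝ, (∀ n, AEMeasurable (b n) P) →
      Tendsto (fun n : ℕ => P {s | ¬ GALS.IsGMMEstimator W (GALS.dataX X n s)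
        (GALS.dataD sigmaSq X n s) (GALS.dataY Y n s) (b n s)}) atTop (𝓝 0) →
      GALS.AsymptoticallyNormal P b β (Gᵀ * W * G)⁻¹) ∧
    -- OLS: its asymptotic covariance, and the comparison with GALS
    (∃ V : Matrix (Fin p) (Fin p) ℝ,
      V = (GALS.jacOLS P (X 0))⁻¹ * GALS.covOLS P (X 0) (ε 0) * (GALS.jacOLS P (X 0))⁻¹ ∧
      GALS.AsymptoticallyNormal P
        (fun n s => GALS.glsEstimator 1 (GALS.dataX X n s) (GALS.dataY Y n s)) β V ∧
      (V - (Gᵀ * W * G)⁻¹).PosSemidef) ∧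
    -- WLS: its asymptotic covariance, and the comparison with GALS
    (∃ V : Matrix (Fin p) (Fin p) ℝ,
      V = (GALS.jacWLS P sigmaSq (X 0))⁻¹ * GALS.covWLS P sigmaSq (X 0) (ε 0)
        * (GALS.jacWLS P sigmaSq (X 0))⁻¹ ∧
      GALS.AsymptoticallyNormal P
        (fun n s => GALS.glsEstimator (GALS.dataD sigmaSq X n s) (GALS.dataX X n s)
          (GALS.dataY Y n s)) β V ∧
      (V - (Gᵀ * W * G)⁻¹).PosSemidef) := by
  have hz := GALS.measurable_instrument (p := p) hσ_meas
  have hD : ∀ n s, (GALS.dataD sigmaSq X n s).IsSymm := fun n s => Matrix.isSymm_diagonal _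
  -- the errors are a function of the data, so that `(X_i, ε_i)` is i.i.d. as well
  have hε_eq : ∀ i, ε i = fun s => Y i s - X i s ⬝ᵥ β := fun i => by
    ext s; rw [hmodel]; ring
  have hdot : Measurable fun x : Fin p → ℝ => x ⬝ᵥ β := by unfold dotProduct; fun_prop
  have hεm : Measurable (ε 0) := by rw [hε_eq]; exact (hY 0).sub (hdot.comp (hX 0))
  have hφ : Measurable fun q : (Fin p → ℝ) × ℝ => (q.1, q.2 - q.1 ⬝ᵥ β) :=
    measurable_fst.prodMk (measurable_snd.sub (hdot.comp measurable_fst))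
  have hindep' : iIndepFun (fun i s => (X i s, ε i s)) P := by
    simp only [hε_eq]
    exact hindep.comp (fun _ q => (q.1, q.2 - q.1 ⬝ᵥ β)) fun _ => hφ
  have hident' : ∀ i, IdentDistrib (fun s => (X i s, ε i s)) (fun s => (X 0 s, ε 0 s)) P P := by
    simp only [hε_eq]
    exact fun i => (hident i).comp hφ
  have hclt := GALS.tendstoInDistribution_moment hσ_meas (hX 0) hεm (hε 0) (hexog 0) hindep'
    hident' hΩ₁₁ hΩ₂₂
  have hlln := GALS.tendsto_sampleJac (X := X) hσ_meas (hindep.comp (fun _ q => q.1) fun _ => measurable_fst)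
    (fun i => (hident i).comp measurable_fst) hG₁ hG₂
  rw [← hG] at hlln
  rw [← hΩ] at hclt
  have hΩpd : Ω.PosDef := by
    rw [hΩ]
    refine (GALS.posSemidef_of_secondMoment (GALS.memLp_moment hσ_meas (hX 0) hεm hΩ₁₁ hΩ₂₂)
      (GALS.integral_moment_mul_moment sigmaSq (X 0) (ε 0))).posDef_iff_isUnit.2 ?_
    rw [← hΩ]
    exact (Matrix.isUnit_iff_isUnit_det _).2 hΩ_det
  have hWpd : W.PosDef := hW ▸ hΩpd.inv
  have hGWG : (Gᵀ * W * G).PosDef := by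
    rw [← conjTranspose_eq_transpose_of_trivial]
    exact hWpd.conjTranspose_mul_mul_same (GALS.mulVec_injective_of_rank hG_rank)
  have hGWG_det : IsUnit (Gᵀ * W * G).det := hGWG.det_pos.ne'.isUnit
  -- GALS is the linear moment estimator with selection matrix `Ĝ' W`
  have hA_eq : ∀ n s, GALS.dataX X n s * A n s
      = ((GALS.sampleJac (GALS.instrument sigmaSq) X n s)ᵀ * W)
        * GALS.dataZ (GALS.instrument sigmaSq) X n s := fun n s => by
    rw [hA, GALS.galsMatrix_eq _ _ (hD n s), GALS.stack_data_eq, GALS.sampleJac,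
      Matrix.transpose_smul, Matrix.transpose_mul, Matrix.transpose_transpose, one_div]
    simp only [Matrix.mul_smul, Matrix.smul_mul, Matrix.mul_assoc]
  have hKm : ∀ n j a, Measurable fun s =>
      ((GALS.sampleJac (GALS.instrument sigmaSq) X n s)ᵀ * W) j a := fun n =>
    GALS.measurable_mul_apply (fun j a => GALS.measurable_sampleJac hz hX n a j)
      fun _ _ => measurable_const
  have hK : ∀ᵐ s ∂P, Tendsto (fun n => (GALS.sampleJac (GALS.instrument sigmaSq) X n s)ᵀ * W)
      atTop (𝓝 (Gᵀ * W)) := by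
    filter_upwards [hlln] with s hs
    exact GALS.tendsto_matrix_mul
      ((continuous_id.matrix_transpose.tendsto G).comp hs) tendsto_const_nhds
  have hprob := GALS.tendsto_measure_isUnit_normal_matrix hz hX hlln hKm hK hGWG_det hA_eq
  have hAN := GALS.asymptoticallyNormal_glsEstimator hz hX hY hmodel hΩpd.posSemidef hclt hlln
    hKm hK hGWG_det hA_eq
  have hopt : ((Gᵀ * W * G)⁻¹ * (Gᵀ * W)) * Ω * ((Gᵀ * W * G)⁻¹ * (Gᵀ * W))ᵀ
      = (Gᵀ * W * G)⁻¹ := by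
    rw [hW] at hGWG_det ⊢
    exact GALS.sandwich_optimal hΩpd hGWG_det
  rw [hopt] at hAN
  -- OLS and WLS select the first and the second block of moments
  have hJ₁ := GALS.isUnit_det_momentMatrix_of_rank (hX 0) hG₁ hG₂ (hG ▸ hG_rank)
    measurable_const (fun _ => one_pos) hG₁
  have hJ₂ := GALS.isUnit_det_momentMatrix_of_rank (hX 0) hG₁ hG₂ (hG ▸ hG_rank)
    (measurable_const.div (hσ_meas.comp (hX 0))) (fun s => one_div_pos.2 (hσ_pos _)) hG₂
  have hselect : ∀ (K : Matrix (Fin p) (Fin p ⊕ Fin p) ℝ) (J C : Matrix (Fin p) (Fin p) ℝ)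
      (B : (n : ℕ) → S → Matrix (Fin n) (Fin n) ℝ), K * G = J → J.IsSymm → IsUnit J.det →
      K * Ω * Kᵀ = C →
      (∀ n s, GALS.dataX X n s * B n s = K * GALS.dataZ (GALS.instrument sigmaSq) X n s) →
      ∃ V : Matrix (Fin p) (Fin p) ℝ, V = J⁻¹ * C * J⁻¹ ∧
        GALS.AsymptoticallyNormal P
          (fun n s => GALS.glsEstimator (B n s) (GALS.dataX X n s) (GALS.dataY Y n s)) β V ∧
        (V - (Gᵀ * W * G)⁻¹).PosSemidef := by
    intro K J C B hKG hJs hJ hKΩ hB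
    have hKGu : IsUnit (K * G).det := hKG ▸ hJ
    have hANK := GALS.asymptoticallyNormal_glsEstimator hz hX hY hmodel hΩpd.posSemidef hclt hlln
      (K := fun _ _ => K) (fun _ _ _ => measurable_const) (ae_of_all _ fun _ => tendsto_const_nhds)
      hKGu hB
    refine ⟨_, rfl, ?_, ?_⟩
    · rwa [GALS.selection_sandwich hJs hKG hKΩ] at hANK
    · rw [← GALS.selection_sandwich hJs hKG hKΩ, hW]
      refine GALS.posSemidef_sandwich_sub hΩpd (hW ▸ hGWG_det) ?_
      rw [Matrix.mul_assoc, Matrix.nonsing_inv_mul _ hKGu]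
  refine ⟨fun n s => ⟨?_, fun b => ?_, fun hdet b => ?_⟩, hprob, hGWG, hAN, fun b hb hmin => ?_,
    ?_, ?_⟩
  · rw [hA, Matrix.IsSymm, ← conjTranspose_eq_transpose_of_trivial]
    exact (GALS.galsMatrix_posSemidef hWpd.posSemidef _ (hD n s)).isHermitian
  · rw [hA]
    exact GALS.gmmCriterion_eq_glsCriterion W _ (hD n s) _ b
  · rw [hA] at hdet ⊢
    exact GALS.isGMMEstimator_iff hWpd.posSemidef _ (hD n s) _ hdet b
  · refine hAN.congr hb ?_
    have hm : ∀ n, MeasurableSet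
        {s | IsUnit (GALS.dataX X n s * A n s * (GALS.dataX X n s)ᵀ).det} := fun n => by
      simp only [hA_eq]
      exact GALS.measurableSet_isUnit_det (GALS.measurable_mul_apply
        (GALS.measurable_mul_apply (hKm n) (GALS.measurable_dataZ hz hX n))
        fun i j => GALS.measurable_dataX hX n j i)
    -- a minimizer is the closed form unless the normal matrix is singular
    have h0 := hmin.add (GALS.tendsto_measure_compl_zero hm hprob)
    rw [add_zero] at h0
    refine tendsto_of_tendsto_of_tendsto_of_le_of_le tendsto_const_nhds h0
      (fun _ => bot_le) fun n => (measure_mono fun s hs => ?_).trans (measure_union_le _ _)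
    by_contra hcon
    rw [Set.mem_union, not_or] at hcon
    obtain ⟨h1, h2⟩ := hcon
    simp only [Set.mem_compl_iff, Set.mem_ofPred_eq, not_not] at h1 h2 hs
    rw [hA] at h2 hs
    exact hs ((GALS.isGMMEstimator_iff hWpd.posSemidef _ (hD n s) _ h2 _).1 h1)
  · refine hselect (Matrix.fromCols 1 0) _ _ (fun _ _ => 1) ?_ (GALS.isSymm_momentMatrix _ _) hJ₁
      ?_ fun n s => ?_
    · rw [hG, GALS.jac, Matrix.fromCols_mul_fromRows, Matrix.one_mul, Matrix.zero_mul, add_zero]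
    · rw [hΩ, GALS.momentCov, Matrix.fromCols_mul_fromBlocks, Matrix.transpose_fromCols,
        Matrix.fromCols_mul_fromRows]
      simp [GALS.covOLS]
    · rw [← GALS.stack_data_eq, GALS.stack, Matrix.fromCols_mul_fromRows, Matrix.mul_one,
        Matrix.one_mul, Matrix.zero_mul, add_zero]
  · refine hselect (Matrix.fromCols 0 1) _ _ (fun n s => GALS.dataD sigmaSq X n s) ?_
      (GALS.isSymm_momentMatrix _ _) hJ₂ ?_ fun n s => ?_
    · rw [hG, GALS.jac, Matrix.fromCols_mul_fromRows, Matrix.one_mul, Matrix.zero_mul, zero_add]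
    · rw [hΩ, GALS.momentCov, Matrix.fromCols_mul_fromBlocks, Matrix.transpose_fromCols,
        Matrix.fromCols_mul_fromRows]
      simp [GALS.covWLS]
    · rw [← GALS.stack_data_eq, GALS.stack, Matrix.fromCols_mul_fromRows, Matrix.one_mul,
        Matrix.zero_mul, zero_add]
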